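/- Let $k$ be a number field with ring of integers $\mathfrak o$ and Dedekind zeta function $\zeta_k(s)$, let $d\ge 0$ be an integer, and put $C=\binom{d+1}{2}$. For indeterminates $X_1,\dots,X_d$ define matrices $c_d(X_1,\dots,X_d)$ with $C$ rows and $d$ columns recursively: $c_0$ is the empty matrix and, for $d\ge1$, $$c_d(X_1,\dots,X_d)=\begin{bmatrix} X_1 1_d\\ \begin{array}{c|c} 0_{\binom d2\times 1} & c_{d-1}(X_2,\dots,X_d)\end{array}\end{bmatrix},$$ where $1_d$ is the $d\times d$ identity matrix. Let $\gamma_d\colon \mathbf Z^d\to \mathrm{Mat}_{C\times d}(\mathbf Z)$ be given by $a\mapsto c_d(a)$, with matrices acting on row vectors from the right, and let $\gamma_d^{\mathfrak o}$ be its base change to $\mathfrak o$. Let $\mathsf H$ be the group functor attached to $\gamma_d^{\mathfrak o}$: for a commutative $\mathfrak o$-algebra $A$, $\mathsf H(A)=A^d\ltimes(A^{C}\oplus A^d)$ is the semidirect product for the action $(x,y).a=(x,\;x\,c_d(a)+y)$ of the additive group $A^d\ni a$ on $A^{C}\oplus A^d\ni(x,y)$. For every ideal $I$ of $\mathfrak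 o$ with $\mathfrak o/I$ finite, the group $\mathsf H(\mathfrak o/I)$ is finite; let $\mathrm k(\mathsf H(\mathfrak o/I))$ be its number of conjugacy classes, and define the conjugacy class zeta function $$\zeta^{\mathrm{cc}}_{\mathsf H}(s)=\sum_{I}\mathrm k(\mathsf H(\mathfrak o/I))\,|\mathfrak o/I|^{-s},$$ the sum extending over all ideals $I$ of $\mathfrak o$ with $|\mathfrak o/I|<\infty$. Then $$\zeta^{\mathrm{cc}}_{\mathsf H}(s)=\frac{\zeta_k(s-C-d)\,\zeta_k(s-C-d+1)}{\zeta_k(s-C+1)},$$ both as an identity of formal Dirichlet series (in which ring the denominator is invertible) and as an identity of complex numbers for every $s\in\mathbf C$ with $\mathrm{Re}(s)>C+d+1$; for such $s$ the series on the left converges absolutely and the denominator on the right is non-zero. -/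

import Mathlib

open CategoryTheory TensorProduct

namespace AskZeta

universe u

section ModuleRepresentations

variable {R : Type*} [CommRing R] {M V W : Type*}
  [AddCommGroup M] [AddCommGroup V] [AddCommGroup W] [Module R M] [Module R V] [Module R W]

/-- Change of scalars of a module representation `θ : M → Hom_R(V, W)` along `R → A`: the module
representation `A ⊗ M → Hom_A(A ⊗ V, A ⊗ W)` with `(s ⊗ a) ↦ (t ⊗ x ↦ s t ⊗ x(aθ))`. -/
noncomputable def changeScalars (θ : M →ₗ[R] V →ₗ[R] W) (A : Type*) [CommRing A] [Algebra R A] :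
    A ⊗[R] M →ₗ[A] A ⊗[R] V →ₗ[A] A ⊗[R] W :=
  LinearMap.liftBaseChange A (LinearMap.baseChangeHom R A V W ∘ₗ θ)

theorem changeScalars_tmul (θ : M →ₗ[R] V →ₗ[R] W) (A : Type*) [CommRing A] [Algebra R A]
    (s t : A) (a : M) (x : V) :
    changeScalars θ A (s ⊗ₜ a) (t ⊗ₜ x) = (s * t) ⊗ₜ θ a x := by
  simp [changeScalars, LinearMap.baseChangeHom, TensorProduct.smul_tmul']

theorem changeScalars_natural (θ : M →ₗ[R] V →ₗ[R] W) {A B : Type*} [CommRing A] [Algebra R A]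
    [CommRing B] [Algebra R B] (f : A →ₐ[R] B) (a : A ⊗[R] M) (x : A ⊗[R] V) :
    f.toLinearMap.rTensor W (changeScalars θ A a x) =
      changeScalars θ B (f.toLinearMap.rTensor M a) (f.toLinearMap.rTensor V x) := by
  induction a with
  | zero => simp
  | add a b ha hb => simp only [map_add, LinearMap.add_apply, ha, hb]
  | tmul s a =>
    induction x with
    | zero => simp
    | add x y hx hy => simp only [map_add, hx, hy]
    | tmul t x => simp [changeScalars_tmul]

/-- The underlying set of the semidirect product `M ⋉ (V ⊕ W)` attached to a module
representation `θ : M → Hom_R(V, W)`. -/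
@[ext]
structure SemidirectGroup (θ : M →ₗ[R] V →ₗ[R] W) where
  /-- the component in the acting group `M` -/
  act : M
  /-- the component in the normal subgroup `V ⊕ W` -/
  vec : V × W

namespace SemidirectGroup

variable (θ : M →ₗ[R] V →ₗ[R] W)

/-- The right action of the additive group `M` on `V ⊕ W`: `(x, y).a = (x, x(aθ) + y)`. -/
def rightAct (p : V × W) (a : M) : V × W := (p.1, θ a p.1 + p.2)

/-- The group law of `M ⋉ (V ⊕ W)` for a right action: `(a, p) (b, q) = (a + b, p.b + q)`. -/
instance : Mul (SemidirectGroup θ) := ⟨fun g h ↦ ⟨g.act + h.act, rightAct θ g.vec h.act + h.vec⟩⟩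

instance : One (SemidirectGroup θ) := ⟨⟨0, 0⟩⟩

instance : Inv (SemidirectGroup θ) := ⟨fun g ↦ ⟨-g.act, -rightAct θ g.vec (-g.act)⟩⟩

theorem mul_def (g h : SemidirectGroup θ) :
    g * h = ⟨g.act + h.act, rightAct θ g.vec h.act + h.vec⟩ := rfl

theorem one_def : (1 : SemidirectGroup θ) = ⟨0, 0⟩ := rfl

theorem inv_def (g : SemidirectGroup θ) : g⁻¹ = ⟨-g.act, -rightAct θ g.vec (-g.act)⟩ := rfl

instance : Group (SemidirectGroup θ) :=
  Group.ofLeftAxioms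
    (by
      intro a b c
      ext <;> simp [mul_def, rightAct] <;> abel)
    (by
      intro a
      ext <;> simp [mul_def, one_def, rightAct])
    (by
      intro a
      ext <;> simp [mul_def, one_def, inv_def, rightAct])

end SemidirectGroup

end ModuleRepresentations

section GroupFunctor

variable {R : Type u} [CommRing R] {M V W : Type u}
  [AddCommGroup M] [AddCommGroup V] [AddCommGroup W] [Module R M] [Module R V] [Module R W]

/-- The group functor `H_θ` on commutative `R`-algebras, `H_θ(A) = M_A ⋉ (V_A ⊕ W_A)`. -/
noncomputable def groupFunctor (θ : M →ₗ[R] V →ₗ[R] W) : CommAlgCat.{u} R ⥤ GrpCat.{u} where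
  obj A := GrpCat.of (SemidirectGroup (changeScalars θ A))
  map {A B} f := GrpCat.ofHom (MonoidHom.mk'
    (fun g ↦ (⟨f.hom.toLinearMap.rTensor M g.act,
      (f.hom.toLinearMap.rTensor V g.vec.1, f.hom.toLinearMap.rTensor W g.vec.2)⟩ :
      SemidirectGroup (changeScalars θ B)))
    (by
      intro g h
      ext <;> simp [SemidirectGroup.mul_def, SemidirectGroup.rightAct, changeScalars_natural]))
  map_id A := by
    ext g
    · exact LinearMap.congr_fun (LinearMap.rTensor_id M A) g.act
    · exact LinearMap.congr_fun (LinearMap.rTensor_id V A) g.vec.1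
    · exact LinearMap.congr_fun (LinearMap.rTensor_id W A) g.vec.2
  map_comp {A B C} f h := by
    ext g
    · exact LinearMap.congr_fun
        (LinearMap.rTensor_comp M h.hom.toLinearMap f.hom.toLinearMap) g.act
    · exact LinearMap.congr_fun
        (LinearMap.rTensor_comp V h.hom.toLinearMap f.hom.toLinearMap) g.vec.1
    · exact LinearMap.congr_fun
        (LinearMap.rTensor_comp W h.hom.toLinearMap f.hom.toLinearMap) g.vec.2

end GroupFunctor

section ZetaFunctions

/-- The class number of a finite group: its number of conjugacy classes. -/
noncomputable def classNumber (G : Type*) [Group G] : ℕ := Nat.card (ConjClasses G)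

variable {R : Type u} [CommRing R]

/-- The class number of `G(R/I)` for a group functor `G` over `R` and an ideal `I` of `R`. -/
noncomputable def quotientClassNumber (G : CommAlgCat.{u} R ⥤ GrpCat.{u}) (I : Ideal R) : ℕ :=
  classNumber (G.obj (CommAlgCat.of R (R ⧸ I)))

/-- The conjugacy class zeta function of a group functor `G` over `R` as a formal Dirichlet
series, i.e. as an element of the ring of arithmetic functions under Dirichlet convolution: the
coefficient of `n ^ (-s)` is the sum of the class numbers of `G(R/I)` over all ideals `I` of `R`
with `|R/I| = n`. -/
noncomputable def ccZetaFormal (G : CommAlgCat.{u} R ⥤ GrpCat.{u}) : ArithmeticFunction ℚ where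
  toFun n := if n = 0 then 0 else
    ∑ᶠ I : {I : Ideal R // Nat.card (R ⧸ I) = n}, (quotientClassNumber G I.1 : ℚ)
  map_zero' := if_pos rfl

/-- The summand `k(G(R/I)) |R/I| ^ (-s)`, for an ideal `I` of finite index, of the conjugacy class
zeta function of a group functor `G` at a complex number `s`. -/
noncomputable def ccZetaTerm (G : CommAlgCat.{u} R ⥤ GrpCat.{u}) (s : ℂ)
    (I : {I : Ideal R // Finite (R ⧸ I)}) : ℂ :=
  (quotientClassNumber G I.1 : ℂ) * (Nat.card (R ⧸ I.1) : ℂ) ^ (-s)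

/-- The shifted Dedekind zeta function `ζ_k(s - c)`, for an integer `c`, as a formal Dirichlet
series: the coefficient of `n ^ (-s)` is `n ^ c` times the number of ideals of norm `n`. -/
noncomputable def dedekindZetaFormal (k : Type*) [Field k] [NumberField k] (c : ℤ) :
    ArithmeticFunction ℚ where
  toFun n := if n = 0 then 0 else
    (Nat.card {I : Ideal (NumberField.RingOfIntegers k) // Ideal.absNorm I = n} : ℚ) * (n : ℚ) ^ c
  map_zero' := if_pos rfl

end ZetaFunctions

section Gamma

theorem rows_succ (d : ℕ) : (d + 1) + (d + 1).choose 2 = (d + 1 + 1).choose 2 := by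
  rw [Nat.choose_succ_succ' (d + 1) 1, Nat.choose_one_right]

/-- The matrix `c_d(X_1, …, X_d)` with `d (d + 1) / 2` rows and `d` columns: `c_0` is empty, and
`c_{d+1}(X_1, …, X_{d+1})` is obtained by stacking `X_1` times the identity matrix of size `d + 1`
on top of `[ 0 | c_d(X_2, …, X_{d+1}) ]`, where `0` is a single zero column. -/
def cMatrix {S : Type*} [CommRing S] :
    (d : ℕ) → (Fin d → S) → Matrix (Fin ((d + 1).choose 2)) (Fin d) S
  | 0, _ => 0
  | d + 1, X =>
    Matrix.reindex (finSumFinEquiv.trans (finCongr (rows_succ d))) (Equiv.refl (Fin (d + 1)))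
      (Matrix.fromRows (Matrix.scalar (Fin (d + 1)) (X 0))
        (Matrix.of fun i ↦ Fin.cons 0 (cMatrix d (fun j ↦ X j.succ) i)))

theorem cMatrix_add {S : Type*} [CommRing S] (d : ℕ) (X Y : Fin d → S) :
    cMatrix d (X + Y) = cMatrix d X + cMatrix d Y := by
  induction d with
  | zero => simp [cMatrix]
  | succ d ih =>
    have h : cMatrix d (fun j ↦ (X + Y) j.succ) =
        cMatrix d (fun j ↦ X j.succ) + cMatrix d (fun j ↦ Y j.succ) := ih _ _
    ext i j
    obtain ⟨i, rfl⟩ := (finSumFinEquiv.trans (finCongr (rows_succ d))).surjective i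
    rcases i with i | i
    · simp [cMatrix, Matrix.diagonal_apply]
      split_ifs <;> simp
    · refine Fin.cases ?_ (fun j ↦ ?_) j <;> simp only [cMatrix, h] <;> simp

theorem cMatrix_smul {S : Type*} [CommRing S] (d : ℕ) (s : S) (X : Fin d → S) :
    cMatrix d (s • X) = s • cMatrix d X := by
  induction d with
  | zero => simp [cMatrix]
  | succ d ih =>
    have h : cMatrix d (fun j ↦ (s • X) j.succ) = s • cMatrix d (fun j ↦ X j.succ) := ih _
    ext i j
    obtain ⟨i, rfl⟩ := (finSumFinEquiv.trans (finCongr (rows_succ d))).surjective i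
    rcases i with i | i
    · simp [cMatrix, Matrix.diagonal_apply]
    · refine Fin.cases ?_ (fun j ↦ ?_) j <;> simp only [cMatrix, h] <;> simp

/-- The module representation `γ_d` of the free abelian group of rank `d` by `ℤ`-matrices with
`d (d + 1) / 2` rows and `d` columns, `a ↦ c_d(a)`; matrices act by right multiplication on row
vectors. -/
def gammaRep (d : ℕ) :
    (Fin d → ℤ) →ₗ[ℤ] (Fin ((d + 1).choose 2) → ℤ) →ₗ[ℤ] (Fin d → ℤ) :=
  LinearMap.mk₂ ℤ (fun a x ↦ Matrix.vecMul x (cMatrix d a))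
    (fun a b x ↦ by rw [cMatrix_add, Matrix.vecMul_add])
    (fun s a x ↦ by rw [cMatrix_smul, Matrix.vecMul_smul])
    (fun a x y ↦ by rw [Matrix.add_vecMul])
    (fun s a x ↦ by rw [Matrix.smul_vecMul])

/-- The group functor `H` over the ring of integers `𝔬` of a number field `k` attached to the
change of scalars of `γ_d` to `𝔬`. -/
noncomputable def gammaGroup (k : Type u) [Field k] [NumberField k] (d : ℕ) :
    CommAlgCat.{u} (NumberField.RingOfIntegers k) ⥤ GrpCat.{u} :=
  groupFunctor (changeScalars (gammaRep d) (NumberField.RingOfIntegers k))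

end Gamma

end AskZeta

/-! Counting commuting pairs in `H(A)` shows that its class number times `|A|^C` is the number
`solutionCount A d` of solutions of `x c_d(b) = x' c_d(a)` (`classNumber_changeScalars_mul`). Fix
the leading entries `a₀`, `b₀` of `a`, `b`. By the block form of `c_{d+1}`, the equation expresses a
vector depending only on the remaining data through `b₀ u - a₀ u'`. It is solvable in `u`, `u'`
exactly when the remaining data solve the rank `d` equation modulo `(a₀, b₀)`, and all nonempty
fibres have the same size (`headCount_mul`).

Now let `A = R/I` and group the pairs `(a₀, b₀)` by the ideal `J ⊇ I` that they generate together
with `I`. Writing `I = D J`, there are as many such pairs as there are unimodular pairs in `R/D`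
(`card_pairIdeal_eq`). After normalization the recursion is thus a Dirichlet convolution over ideals
(`solutionDensity_succ`). Classifying all pairs in `R/I` in this way gives `∑_{D ∣ I} U(D) =
N(I)^2`, where `U` counts unimodular pairs, so `∑ U(D) N(D)^{c-s} = ζ(s-c-2)/ζ(s-c)`. The product of
these quotients telescopes (`solutionDensity_mul_shiftedZeta`).

For the analytic statement, nonnegativity of the coefficients transfers absolute convergence from
the numerator, and a finite sieve over primes shows `ζ_k ≠ 0` for `Re s > 1`. -/

namespace AskZeta

/-! ### Fibres and preimages of homomorphisms of finite additive groups -/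

section Counting

/-- Every fibre of a homomorphism of additive groups over a point of its range is in bijection with
the kernel. -/
theorem card_fiber_eq_card_ker {G H : Type*} [AddCommGroup G] [AddCommGroup H] (φ : G →+ H) {h : H}
    (hh : h ∈ φ.range) : Nat.card {g // φ g = h} = Nat.card φ.ker := by
  obtain ⟨g₀, rfl⟩ := hh
  exact Nat.card_congr
    { toFun := fun g ↦ ⟨g.1 - g₀, by simp [AddMonoidHom.mem_ker, g.2]⟩
      invFun := fun g ↦ ⟨g.1 + g₀, by simp [AddMonoidHom.mem_ker.1 g.2]⟩
      left_inv := fun g ↦ by simp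
      right_inv := fun g ↦ by simp }

theorem card_ker_mul_card_range {G H : Type*} [AddCommGroup G] [AddCommGroup H] (φ : G →+ H) :
    Nat.card φ.ker * Nat.card φ.range = Nat.card G := by
  rw [← Nat.card_congr (QuotientAddGroup.quotientKerEquivRange φ).toEquiv,
    AddSubgroup.card_eq_card_quotient_mul_card_addSubgroup φ.ker, mul_comm]

/-- The preimage of a set under a surjective homomorphism of finite additive groups. -/
theorem card_preimage_mul_card {G H : Type*} [AddCommGroup G] [AddCommGroup H] [Finite G]
    [Finite H] (φ : G →+ H) (hφ : Function.Surjective φ) (p : H → Prop) :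
    Nat.card {g // p (φ g)} * Nat.card H = Nat.card G * Nat.card {h // p h} := by
  classical
  have e : {g // p (φ g)} ≃ Σ h : {h // p h}, {g // φ g = h.1} :=
    { toFun := fun g ↦ ⟨⟨φ g.1, g.2⟩, g.1, rfl⟩
      invFun := fun x ↦ ⟨x.2.1, by rw [x.2.2]; exact x.1.2⟩
      left_inv := fun g ↦ rfl
      right_inv := by
        rintro ⟨⟨h, hh⟩, g, hg⟩
        obtain rfl : φ g = h := hg
        rfl }
  have := Fintype.ofFinite {h // p h}
  have h1 : ∀ h : {h // p h}, Nat.card {g // φ g = h.1} = Nat.card φ.ker := fun h ↦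
    card_fiber_eq_card_ker φ (hφ h.1)
  have h2 := card_ker_mul_card_range φ
  rw [AddMonoidHom.range_eq_top.2 hφ, AddSubgroup.card_top] at h2
  rw [Nat.card_congr e, Nat.card_sigma, Finset.sum_congr rfl fun h _ ↦ h1 h, Finset.sum_const,
    ← h2, Finset.card_univ, ← Nat.card_eq_fintype_card, smul_eq_mul]
  ring

end Counting

/-! ### Recursion in `d` for the number of solutions -/

section SolutionCount

/-- The number of solutions of `x c_d(b) = x' c_d(a)` over a ring. -/
noncomputable def solutionCount (A : Type*) [CommRing A] (d : ℕ) : ℕ :=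
  Nat.card {p : ((Fin d → A) × (Fin d → A)) ×
      ((Fin ((d + 1).choose 2) → A) × (Fin ((d + 1).choose 2) → A)) //
    Matrix.vecMul p.2.1 (cMatrix d p.1.2) = Matrix.vecMul p.2.2 (cMatrix d p.1.1)}

variable {A B : Type*} [CommRing A] [CommRing B]

theorem cMatrix_map (f : A →+* B) (d : ℕ) (X : Fin d → A) :
    (cMatrix d X).map f = cMatrix d (f ∘ X) := by
  induction d with
  | zero => ext i j; exact j.elim0
  | succ d ih =>
    ext i j
    obtain ⟨i, rfl⟩ := (finSumFinEquiv.trans (finCongr (rows_succ d))).surjective i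
    rcases i with i | i
    · simp [cMatrix, Matrix.diagonal_apply, apply_ite f]
    · refine Fin.cases ?_ (fun j ↦ ?_) j
      · simp [cMatrix]
      · have h := congrFun (congrFun (ih fun j ↦ X j.succ) i) j
        simp only [Matrix.map_apply] at h
        simpa [cMatrix, Function.comp_def] using h

/-- Splitting the row index set of `c_{d+1}`. -/
def rowsEquiv (d : ℕ) : Fin (d + 1) ⊕ Fin ((d + 1).choose 2) ≃ Fin ((d + 1 + 1).choose 2) :=
  finSumFinEquiv.trans (finCongr (rows_succ d))

theorem vecMul_cMatrix_succ (d : ℕ) (X₀ : A) (X : Fin d → A) (u : Fin (d + 1) → A)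
    (r : Fin ((d + 1).choose 2) → A) :
    Matrix.vecMul (Sum.elim u r ∘ (rowsEquiv d).symm)
        (cMatrix (d + 1) (Fin.cons X₀ X : Fin (d + 1) → A)) =
      X₀ • u + (Fin.cons 0 (Matrix.vecMul r (cMatrix d X)) : Fin (d + 1) → A) := by
  have h : cMatrix (d + 1) (Fin.cons X₀ X : Fin (d + 1) → A) =
      (Matrix.fromRows (Matrix.scalar (Fin (d + 1)) X₀)
        (Matrix.of fun i ↦ Fin.cons 0 (cMatrix d X i))).submatrix (rowsEquiv d).symm id := rfl
  rw [h]
  have h2 : ∀ N : Matrix (Fin (d + 1) ⊕ Fin ((d + 1).choose 2)) (Fin (d + 1)) A,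
      Matrix.vecMul (Sum.elim u r ∘ (rowsEquiv d).symm) (N.submatrix (rowsEquiv d).symm id) =
        Matrix.vecMul (Sum.elim u r) N := by
    intro N
    ext j
    simp only [Matrix.vecMul, dotProduct, Function.comp_apply, Matrix.submatrix_apply, id]
    exact Equiv.sum_comp (rowsEquiv d).symm fun i ↦ Sum.elim u r i * N i j
  rw [h2, Matrix.vecMul_fromRows]
  ext j
  simp only [Sum.elim_comp_inl, Sum.elim_comp_inr, Pi.add_apply, Matrix.scalar_apply,
    Matrix.vecMul_diagonal, Pi.smul_apply, smul_eq_mul, mul_comm X₀]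
  congr 1
  refine Fin.cases ?_ (fun j ↦ ?_) j <;> simp [Matrix.vecMul, dotProduct]

/-- The number of solutions with prescribed first coordinates `a₀`, `b₀`. -/
noncomputable def headCount (A : Type*) [CommRing A] (d : ℕ) (c : A × A) : ℕ :=
  Nat.card {q : (((Fin d → A) × (Fin d → A)) ×
      ((Fin ((d + 1).choose 2) → A) × (Fin ((d + 1).choose 2) → A))) ×
        ((Fin (d + 1) → A) × (Fin (d + 1) → A)) //
    c.2 • q.2.1 + (Fin.cons 0 (Matrix.vecMul q.1.2.1 (cMatrix d q.1.1.2)) : Fin (d + 1) → A) =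
    c.1 • q.2.2 + (Fin.cons 0 (Matrix.vecMul q.1.2.2 (cMatrix d q.1.1.1)) : Fin (d + 1) → A)}

/-- Joining vectors of coefficients along `rowsEquiv`. -/
def joinEquiv (A : Type*) (d : ℕ) :
    (Fin (d + 1) → A) × (Fin ((d + 1).choose 2) → A) ≃ (Fin ((d + 1 + 1).choose 2) → A) :=
  (Equiv.sumArrowEquivProdArrow _ _ _).symm.trans ((rowsEquiv d).arrowCongr (Equiv.refl A))

theorem joinEquiv_apply {A : Type*} (d : ℕ) (u : Fin (d + 1) → A) (r : Fin ((d + 1).choose 2) → A) :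
    joinEquiv A d (u, r) = Sum.elim u r ∘ (rowsEquiv d).symm := rfl

theorem solutionCount_succ [Fintype A] (d : ℕ) :
    solutionCount A (d + 1) = ∑ c : A × A, headCount A d c := by
  simp only [headCount]
  rw [← Nat.card_sigma]
  let e : (A × A) × ((((Fin d → A) × (Fin d → A)) ×
      ((Fin ((d + 1).choose 2) → A) × (Fin ((d + 1).choose 2) → A))) ×
        ((Fin (d + 1) → A) × (Fin (d + 1) → A))) ≃
      ((Fin (d + 1) → A) × (Fin (d + 1) → A)) ×
      ((Fin ((d + 1 + 1).choose 2) → A) × (Fin ((d + 1 + 1).choose 2) → A)) :=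
    { toFun := fun x ↦ ((Fin.consEquiv (fun _ ↦ A) (x.1.1, x.2.1.1.1),
          Fin.consEquiv (fun _ ↦ A) (x.1.2, x.2.1.1.2)),
          (joinEquiv A d (x.2.2.1, x.2.1.2.1), joinEquiv A d (x.2.2.2, x.2.1.2.2)))
      invFun := fun y ↦
        let a := (Fin.consEquiv (fun _ ↦ A)).symm y.1.1
        let b := (Fin.consEquiv (fun _ ↦ A)).symm y.1.2
        let x := (joinEquiv A d).symm y.2.1
        let x' := (joinEquiv A d).symm y.2.2
        ((a.1, b.1), (((a.2, b.2), (x.2, x'.2)), (x.1, x'.1)))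
      left_inv := fun x ↦ by simp
      right_inv := fun y ↦ by
        simp only [Prod.mk.eta, Equiv.apply_symm_apply] }
  refine Nat.card_congr (Equiv.trans (Equiv.subtypeEquiv e ?_).symm
    (Equiv.subtypeProdEquivSigmaSubtype (fun (c : A × A)
      (q : (((Fin d → A) × (Fin d → A)) ×
      ((Fin ((d + 1).choose 2) → A) × (Fin ((d + 1).choose 2) → A))) ×
        ((Fin (d + 1) → A) × (Fin (d + 1) → A))) ↦
      c.2 • q.2.1 + (Fin.cons 0 (Matrix.vecMul q.1.2.1 (cMatrix d q.1.1.2)) : Fin (d + 1) → A) =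
      c.1 • q.2.2 + (Fin.cons 0 (Matrix.vecMul q.1.2.2 (cMatrix d q.1.1.1)) : Fin (d + 1) → A))))
  rintro ⟨⟨a₀, b₀⟩, ⟨⟨a, b⟩, ⟨r, r'⟩⟩, ⟨u, u'⟩⟩
  have h1 := vecMul_cMatrix_succ d b₀ b u r
  have h2 := vecMul_cMatrix_succ d a₀ a u' r'
  rw [← joinEquiv_apply] at h1 h2
  have h3 : Matrix.vecMul (joinEquiv A d (u, r)) (cMatrix (d + 1) (Fin.cons b₀ b : Fin (d + 1) → A))
    = Matrix.vecMul (joinEquiv A d (u', r')) (cMatrix (d + 1) (Fin.cons a₀ a : Fin (d + 1) → A)) ↔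
    b₀ • u + (Fin.cons 0 (Matrix.vecMul r (cMatrix d b)) : Fin (d + 1) → A) =
    a₀ • u' + (Fin.cons 0 (Matrix.vecMul r' (cMatrix d a)) : Fin (d + 1) → A) := by
    rw [h1, h2]
  exact h3.symm

/-- The additive map `(u, v) ↦ b u - a v`. -/
def pairMap (c : A × A) : A × A →+ A where
  toFun p := c.2 * p.1 - c.1 * p.2
  map_zero' := by simp
  map_add' p q := by simp only [Prod.fst_add, Prod.snd_add]; ring

theorem mem_range_pairMap (c : A × A) (x : A) :
    x ∈ (pairMap c).range ↔ x ∈ Ideal.span {c.1, c.2} := by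
  rw [Ideal.mem_span_pair, AddMonoidHom.mem_range]
  constructor
  · rintro ⟨p, rfl⟩
    exact ⟨-p.2, p.1, by simp [pairMap]; ring⟩
  · rintro ⟨p, q, rfl⟩
    exact ⟨(q, -p), by simp [pairMap]; ring⟩

/-- The image of `pairMap c` is the ideal generated by the two entries, whose index is `|B|`; hence
the kernel has order `|A|^2 / (|A| / |B|)`. -/
theorem card_ker_pairMap [Finite A] [Finite B] (c : A × A) (f : A →+* B)
    (hf : Function.Surjective f) (hk : RingHom.ker f = Ideal.span {c.1, c.2}) :
    Nat.card (pairMap c).ker = Nat.card A * Nat.card B := by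
  have h1 := card_ker_mul_card_range (pairMap c)
  have h2 := card_ker_mul_card_range f.toAddMonoidHom
  have h3 : f.toAddMonoidHom.ker = (pairMap c).range := by
    ext x
    rw [mem_range_pairMap, ← hk]
    rfl
  rw [AddMonoidHom.range_eq_top.2 hf, AddSubgroup.card_top, h3] at h2
  rw [Nat.card_prod, ← h2] at h1
  have h4 : 0 < Nat.card (pairMap c).range := Nat.card_pos
  apply Nat.eq_of_mul_eq_mul_right h4
  rw [h1, ← h2]
  ring

/-- The equation decouples over coordinates, each asking for a fibre of `pairMap c`: empty off the
ideal, a coset of the kernel on it. -/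
theorem card_pair_fiber [Finite A] (d : ℕ) (c : A × A) (v w : Fin d → A) [Decidable
    (∀ i, v i - w i ∈ Ideal.span {c.1, c.2})] :
    Nat.card {p : (Fin d → A) × (Fin d → A) // c.2 • p.1 + w = c.1 • p.2 + v} =
      if ∀ i, v i - w i ∈ Ideal.span {c.1, c.2} then Nat.card (pairMap c).ker ^ d else 0 := by
  have e : {p : (Fin d → A) × (Fin d → A) // c.2 • p.1 + w = c.1 • p.2 + v} ≃
      ∀ i, {p : A × A // pairMap c p = v i - w i} := by
    refine Equiv.trans (Equiv.subtypeEquiv (Equiv.arrowProdEquivProdArrow (Fin d)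
      (fun _ ↦ A) (fun _ ↦ A)).symm ?_) (Equiv.subtypePiEquivPi (p := fun i p ↦
      pairMap c p = v i - w i))
    rintro ⟨p, q⟩
    rw [funext_iff]
    refine forall_congr' fun i ↦ ?_
    simp only [pairMap, Pi.add_apply, Pi.smul_apply, smul_eq_mul,
      Equiv.arrowProdEquivProdArrow, Equiv.coe_fn_symm_mk, AddMonoidHom.coe_mk, ZeroHom.coe_mk]
    rw [sub_eq_sub_iff_add_eq_add, add_comm (v i)]
  rw [Nat.card_congr e, Nat.card_pi]
  split_ifs with h
  · rw [Finset.prod_congr rfl fun i _ ↦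
      card_fiber_eq_card_ker (pairMap c) ((mem_range_pairMap c _).2 (h i))]
    simp
  · push Not at h
    obtain ⟨i, hi⟩ := h
    refine Finset.prod_eq_zero (Finset.mem_univ i) ?_
    rw [Nat.card_eq_zero]
    left
    refine ⟨fun p ↦ hi ((mem_range_pairMap c _).1 ⟨p.1, p.2⟩)⟩

/-- Solvability in `(u, u')` depends only on the images in `B` of the remaining data, where it is
the rank `d` equation. The factor `(|A| |B|)^(d+1)` counts the pairs `(u, u')`; the other powers
compare `A` and `B` in the `2d + 2C` remaining coordinates. -/
theorem headCount_mul [Finite A] [Finite B] (d : ℕ) (c : A × A) (f : A →+* B)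
    (hf : Function.Surjective f) (hk : RingHom.ker f = Ideal.span {c.1, c.2}) :
    headCount A d c * Nat.card B ^ (2 * d + 2 * (d + 1).choose 2) =
      (Nat.card A * Nat.card B) ^ (d + 1) * Nat.card A ^ (2 * d + 2 * (d + 1).choose 2) *
        solutionCount B d := by
  classical
  have := Fintype.ofFinite A
  set C := (d + 1).choose 2 with hC
  let mem : ((Fin d → A) × (Fin d → A)) × ((Fin C → A) × (Fin C → A)) → Prop := fun q ↦
    ∀ i, Matrix.vecMul q.2.2 (cMatrix d q.1.1) i - Matrix.vecMul q.2.1 (cMatrix d q.1.2) i ∈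
      Ideal.span {c.1, c.2}
  have h1 : headCount A d c = Nat.card {q // mem q} * (Nat.card A * Nat.card B) ^ (d + 1) := by
    rw [headCount, Nat.card_congr (Equiv.subtypeProdEquivSigmaSubtype (fun
      (q : ((Fin d → A) × (Fin d → A)) × ((Fin C → A) × (Fin C → A)))
      (p : (Fin (d + 1) → A) × (Fin (d + 1) → A)) ↦
      c.2 • p.1 + (Fin.cons 0 (Matrix.vecMul q.2.1 (cMatrix d q.1.2)) : Fin (d + 1) → A) =
      c.1 • p.2 + (Fin.cons 0 (Matrix.vecMul q.2.2 (cMatrix d q.1.1)) : Fin (d + 1) → A))),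
      Nat.card_sigma]
    simp only [card_pair_fiber, card_ker_pairMap c f hf hk]
    rw [Finset.sum_ite, Finset.sum_const_zero, add_zero, Finset.sum_const, smul_eq_mul]
    congr 1
    rw [Nat.card_eq_fintype_card, Fintype.card_subtype]
    -- Both sides vanish in coordinate `0` because of the zero column, so only the last `d`
    -- coordinates impose a condition.
    congr 1
    ext q
    simp only [mem, Finset.mem_filter, Finset.mem_univ, true_and, Fin.forall_fin_succ]
    simp
  let φ : ((Fin d → A) × (Fin d → A)) × ((Fin C → A) × (Fin C → A)) →+
      ((Fin d → B) × (Fin d → B)) × ((Fin C → B) × (Fin C → B)) :=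
    ((f.toAddMonoidHom.compLeft _).prodMap (f.toAddMonoidHom.compLeft _)).prodMap
      ((f.toAddMonoidHom.compLeft _).prodMap (f.toAddMonoidHom.compLeft _))
  have hs : ∀ n, Function.Surjective (f.toAddMonoidHom.compLeft (Fin n)) := fun n ↦
    hf.comp_left
  have h2 := card_preimage_mul_card φ (((hs d).prodMap (hs d)).prodMap ((hs C).prodMap (hs C)))
    (fun q ↦ Matrix.vecMul q.2.1 (cMatrix d q.1.2) = Matrix.vecMul q.2.2 (cMatrix d q.1.1))
  have h3 : ∀ q, (Matrix.vecMul (φ q).2.1 (cMatrix d (φ q).1.2) =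
      Matrix.vecMul (φ q).2.2 (cMatrix d (φ q).1.1)) ↔ mem q := by
    rintro ⟨⟨a, b⟩, ⟨x, y⟩⟩
    have h4 : ∀ (x : Fin C → A) (a : Fin d → A), Matrix.vecMul (f ∘ x) (cMatrix d (f ∘ a)) =
        f ∘ Matrix.vecMul x (cMatrix d a) := by
      intro x a
      rw [← cMatrix_map]
      ext i
      exact (RingHom.map_vecMul f _ _ i).symm
    change Matrix.vecMul (f ∘ x) (cMatrix d (f ∘ b)) = Matrix.vecMul (f ∘ y) (cMatrix d (f ∘ a)) ↔ _
    rw [h4, h4, funext_iff]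
    refine forall_congr' fun i ↦ ?_
    rw [← hk, RingHom.mem_ker, map_sub, sub_eq_zero]
    exact eq_comm
  simp only [h3] at h2
  simp only [Nat.card_prod, Nat.card_fun, Nat.card_eq_fintype_card (α := Fin _),
    Fintype.card_fin] at h2
  have h5 : ∀ n : ℕ, n ^ (2 * d + 2 * C) = n ^ d * n ^ d * (n ^ C * n ^ C) := fun n ↦ by ring
  rw [h1, h5, h5, solutionCount]
  calc _ = (Nat.card {q // mem q} * (Nat.card B ^ d * Nat.card B ^ d *
        (Nat.card B ^ C * Nat.card B ^ C))) * (Nat.card A * Nat.card B) ^ (d + 1) := by ring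
    _ = _ := by rw [h2]; ring

end SolutionCount

universe u

/-! ### Class numbers as solution counts -/

section ClassNumbers

namespace SemidirectGroup

variable {R : Type*} [CommRing R] {M V W : Type*}
  [AddCommGroup M] [AddCommGroup V] [AddCommGroup W] [Module R M] [Module R V] [Module R W]
  (θ : M →ₗ[R] V →ₗ[R] W)

theorem commute_iff (g h : SemidirectGroup θ) :
    Commute g h ↔ θ h.act g.vec.1 = θ g.act h.vec.1 := by
  rw [commute_iff_eq, SemidirectGroup.ext_iff, mul_def, mul_def]
  simp only [rightAct, Prod.ext_iff, Prod.fst_add, Prod.snd_add,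
    add_comm h.act, add_comm h.vec.1, true_and]
  rw [add_assoc, add_assoc, add_comm h.vec.2, add_left_inj]

/-- The underlying set of the semidirect product is a product. -/
def equivProd : SemidirectGroup θ ≃ (M × V) × W where
  toFun g := ((g.act, g.vec.1), g.vec.2)
  invFun x := ⟨x.1.1, (x.1.2, x.2)⟩
  left_inv _ := rfl
  right_inv _ := rfl

instance [Finite M] [Finite V] [Finite W] : Finite (SemidirectGroup θ) :=
  Finite.of_equiv _ (equivProd θ).symm

/-- The number of commuting pairs is the class number times the group order. Commutation does not
involve the `W`-components, so a factor `|W|^2` splits off; with `|M| = |W|` it cancels against `|M|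
|W|` in the group order. -/
theorem classNumber_mul_card [Finite M] [Finite V] [Finite W] (h : Nat.card M = Nat.card W) :
    classNumber (SemidirectGroup θ) * Nat.card V =
      Nat.card {p : (M × M) × (V × V) // θ p.1.2 p.2.1 = θ p.1.1 p.2.2} := by
  have h1 := card_comm_eq_card_conjClasses_mul_card (SemidirectGroup θ)
  let e : {p : SemidirectGroup θ × SemidirectGroup θ // Commute p.1 p.2} ≃
      {p : (M × M) × (V × V) // θ p.1.2 p.2.1 = θ p.1.1 p.2.2} × (W × W) :=
    { toFun := fun p ↦ (⟨((p.1.1.act, p.1.2.act), (p.1.1.vec.1, p.1.2.vec.1)),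
        (commute_iff θ _ _).1 p.2⟩, (p.1.1.vec.2, p.1.2.vec.2))
      invFun := fun q ↦ ⟨(⟨q.1.1.1.1, (q.1.1.2.1, q.2.1)⟩, ⟨q.1.1.1.2, (q.1.1.2.2, q.2.2)⟩),
        (commute_iff θ _ _).2 q.1.2⟩
      left_inv := fun _ ↦ rfl
      right_inv := fun _ ↦ rfl }
  rw [Nat.card_congr e, Nat.card_congr (equivProd θ), Nat.card_prod, Nat.card_prod, Nat.card_prod,
    Nat.card_prod, h] at h1
  have h2 : 0 < Nat.card W * Nat.card W := mul_pos Nat.card_pos Nat.card_pos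
  apply Nat.eq_of_mul_eq_mul_right h2
  rw [h1, classNumber]
  ring

end SemidirectGroup

variable {R : Type*} [CommRing R] (A : Type*) [CommRing A] [Algebra R A]

/-- Extending the scalars of `ℤ^n` twice yields `A^n`. -/
noncomputable def baseChangeEquiv (n : ℕ) : A ⊗[R] (R ⊗[ℤ] (Fin n → ℤ)) ≃ₗ[A] (Fin n → A) :=
  (AlgebraTensorModule.cancelBaseChange ℤ R A A (Fin n → ℤ)).trans
    (TensorProduct.piScalarRight ℤ A A (Fin n))

theorem baseChangeEquiv_tmul (n : ℕ) (s : A) (r : R) (x : Fin n → ℤ) :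
    baseChangeEquiv A n (s ⊗ₜ (r ⊗ₜ x)) = (r • s) • (Int.castRingHom A ∘ x) := by
  ext i
  simp [baseChangeEquiv, mul_comm]

/-- Both sides are biadditive, which reduces the claim to pure tensors of integer vectors; there it
follows from linearity of `cMatrix` and its compatibility with ring maps. -/
theorem baseChangeEquiv_changeScalars (d : ℕ) (a : A ⊗[R] (R ⊗[ℤ] (Fin d → ℤ)))
    (x : A ⊗[R] (R ⊗[ℤ] (Fin ((d + 1).choose 2) → ℤ))) :
    baseChangeEquiv A d (changeScalars (changeScalars (gammaRep d) R) A a x) =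
      Matrix.vecMul (baseChangeEquiv A _ x) (cMatrix d (baseChangeEquiv A d a)) := by
  induction a with
  | zero =>
    have h : cMatrix d (0 : Fin d → A) = 0 := by simpa using cMatrix_smul d (0 : A) 0
    simp [h]
  | add a b ha hb =>
    simp only [map_add, LinearMap.add_apply, ha, hb, cMatrix_add, Matrix.vecMul_add]
  | tmul s a =>
  induction a with
  | zero =>
    have h : cMatrix d (0 : Fin d → A) = 0 := by simpa using cMatrix_smul d (0 : A) 0
    simp [h]
  | add a b ha hb =>
    simp only [map_add, LinearMap.add_apply, ha, hb, cMatrix_add, Matrix.vecMul_add,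
      TensorProduct.tmul_add]
  | tmul r a =>
  induction x with
  | zero => simp
  | add x y hx hy => simp only [map_add, hx, hy, Matrix.add_vecMul]
  | tmul t x =>
  induction x with
  | zero => simp
  | add x y hx hy => simp only [map_add, hx, hy, Matrix.add_vecMul, TensorProduct.tmul_add]
  | tmul q x =>
    rw [changeScalars_tmul, changeScalars_tmul]
    simp only [baseChangeEquiv_tmul, cMatrix_smul, Matrix.smul_vecMul, Matrix.vecMul_smul,
      ← cMatrix_map]
    have h : (Int.castRingHom A) ∘ (gammaRep d a x) = Matrix.vecMul (Int.castRingHom A ∘ x)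
        ((cMatrix d a).map (Int.castRingHom A)) := by
      ext i
      exact RingHom.map_vecMul (Int.castRingHom A) (cMatrix d a) x i
    rw [h, smul_smul]
    congr 1
    simp only [Algebra.smul_def, map_mul]
    ring

theorem finite_baseChange [Finite A] (n : ℕ) : Finite (A ⊗[R] (R ⊗[ℤ] (Fin n → ℤ))) :=
  Finite.of_equiv _ (baseChangeEquiv A n).toEquiv.symm

theorem classNumber_changeScalars_mul [Finite A] (d : ℕ) :
    classNumber (SemidirectGroup (changeScalars (changeScalars (gammaRep d) R) A)) *
      Nat.card A ^ ((d + 1).choose 2) = solutionCount A d := by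
  have := finite_baseChange (R := R) A d
  have := finite_baseChange (R := R) A ((d + 1).choose 2)
  have h := SemidirectGroup.classNumber_mul_card (changeScalars (changeScalars (gammaRep d) R) A)
    rfl
  rw [Nat.card_congr (baseChangeEquiv (R := R) A ((d + 1).choose 2)).toEquiv, Nat.card_fun,
    Nat.card_eq_fintype_card (α := Fin _), Fintype.card_fin] at h
  rw [h, solutionCount]
  refine Nat.card_congr (Equiv.subtypeEquiv (((baseChangeEquiv A d).toEquiv.prodCongr
    (baseChangeEquiv A d).toEquiv).prodCongr ((baseChangeEquiv A _).toEquiv.prodCongr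
    (baseChangeEquiv A _).toEquiv)) ?_)
  rintro ⟨⟨a, b⟩, ⟨x, y⟩⟩
  rw [← (baseChangeEquiv A d).injective.eq_iff, baseChangeEquiv_changeScalars,
    baseChangeEquiv_changeScalars]
  rfl

variable (k : Type u) [Field k] [NumberField k]

theorem finite_gammaGroup_obj (d : ℕ) (I : Ideal (NumberField.RingOfIntegers k))
    [Finite (NumberField.RingOfIntegers k ⧸ I)] :
    Finite ((gammaGroup k d).obj
      (CommAlgCat.of (NumberField.RingOfIntegers k) (NumberField.RingOfIntegers k ⧸ I))) := by
  have := finite_baseChange (R := NumberField.RingOfIntegers k)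
    (NumberField.RingOfIntegers k ⧸ I) d
  have := finite_baseChange (R := NumberField.RingOfIntegers k)
    (NumberField.RingOfIntegers k ⧸ I) ((d + 1).choose 2)
  exact inferInstanceAs (Finite (SemidirectGroup (changeScalars (changeScalars (gammaRep d)
    (NumberField.RingOfIntegers k)) (NumberField.RingOfIntegers k ⧸ I))))

theorem quotientClassNumber_gammaGroup_mul (d : ℕ) (I : Ideal (NumberField.RingOfIntegers k))
    [Finite (NumberField.RingOfIntegers k ⧸ I)] :
    quotientClassNumber (gammaGroup k d) I *
      Nat.card (NumberField.RingOfIntegers k ⧸ I) ^ ((d + 1).choose 2) =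
        solutionCount (NumberField.RingOfIntegers k ⧸ I) d :=
  classNumber_changeScalars_mul (NumberField.RingOfIntegers k ⧸ I) d

end ClassNumbers

/-! ### Pairs in `R/I` and the ideals they generate -/

section Pairs

variable {R : Type*} [CommRing R]

/-- The number of pairs of elements of `R/D` generating the unit ideal. -/
noncomputable def unimodularPairs (D : Ideal R) : ℕ :=
  Nat.card {p : (R ⧸ D) × (R ⧸ D) // Ideal.span {p.1, p.2} = ⊤}

/-- The ideal of `R` generated by `I` and representatives of two elements of `R/I`. -/
def pairIdeal (I : Ideal R) (p : (R ⧸ I) × (R ⧸ I)) : Ideal R :=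
  (Ideal.span {p.1, p.2}).comap (Ideal.Quotient.mk I)

theorem pairIdeal_mk (I : Ideal R) (x y : R) :
    pairIdeal I (Ideal.Quotient.mk I x, Ideal.Quotient.mk I y) = I ⊔ Ideal.span {x, y} := by
  rw [pairIdeal, ← Ideal.comap_map_quotientMk, Ideal.map_span, Set.image_pair]

theorem le_pairIdeal (I : Ideal R) (p : (R ⧸ I) × (R ⧸ I)) : I ≤ pairIdeal I p := by
  obtain ⟨⟨x⟩, ⟨y⟩⟩ := p
  exact (pairIdeal_mk I x y).symm ▸ le_sup_left

theorem ker_factor_pairIdeal (I : Ideal R) (p : (R ⧸ I) × (R ⧸ I)) :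
    RingHom.ker (Ideal.Quotient.factor (le_pairIdeal I p)) = Ideal.span {p.1, p.2} := by
  rw [Ideal.Quotient.factor_ker, pairIdeal,
    Ideal.map_comap_of_surjective _ Ideal.Quotient.mk_surjective]

theorem span_pair_mk_eq_top_iff (D : Ideal R) (x y : R) :
    Ideal.span {Ideal.Quotient.mk D x, Ideal.Quotient.mk D y} = ⊤ ↔ D ⊔ Ideal.span {x, y} = ⊤ := by
  rw [← pairIdeal_mk, pairIdeal, Ideal.comap_eq_top_iff]

/-- In a Dedekind domain `J = D J + (t)` for some `t`. Multiplication by `t` identifies `R/D` with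
`J/DJ`, and pairs generating `R/D` correspond to pairs generating `J` modulo `D J`. -/
theorem card_pairIdeal_eq [IsDedekindDomain R] (D J : Ideal R) (h : D * J ≠ ⊥) :
    Nat.card {p : (R ⧸ (D * J)) × (R ⧸ (D * J)) // pairIdeal (D * J) p = J} =
      unimodularPairs D := by
  obtain ⟨t, ht⟩ := IsDedekindDomain.exists_sup_span_eq (Ideal.mul_le_right : D * J ≤ J) h
  have hJ : J ≠ 0 := by rintro rfl; simp at h
  have htJ : t ∈ J := by
    rw [← ht]; exact Ideal.mem_sup_right (Ideal.mem_span_singleton_self t)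
  let ψ : R ⧸ D →ₗ[R] R ⧸ (D * J) := Submodule.mapQ D (D * J) (LinearMap.mulLeft R t) (by
    intro x hx
    rw [Submodule.mem_comap, LinearMap.mulLeft_apply, mul_comm t]
    exact Ideal.mul_mem_mul hx htJ)
  have hψ : ∀ x, ψ (Ideal.Quotient.mk D x) = Ideal.Quotient.mk (D * J) (t * x) := fun x ↦ rfl
  have hinj : Function.Injective ψ := by
    rw [injective_iff_map_eq_zero]
    rintro ⟨x⟩ hx
    change ψ (Ideal.Quotient.mk D x) = 0 at hx
    rw [hψ, Ideal.Quotient.eq_zero_iff_mem] at hx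
    refine Ideal.Quotient.eq_zero_iff_mem.2 ?_
    -- `x ∈ D` is tested after multiplication by `J`: `(x) J = (x) D J + (x t)` lies in `D J` as
    -- soon as `t x` does.
    rw [← Ideal.span_singleton_le_iff_mem, ← Ideal.dvd_iff_le, ← mul_dvd_mul_iff_right hJ,
      Ideal.dvd_iff_le]
    nth_rewrite 1 [← ht]
    rw [Ideal.mul_sup, sup_le_iff]
    refine ⟨Ideal.mul_le_right, ?_⟩
    rw [Ideal.span_singleton_mul_span_singleton, Ideal.span_singleton_le_iff_mem, mul_comm x]
    exact hx
  have hiff : ∀ p : (R ⧸ D) × (R ⧸ D), Ideal.span {p.1, p.2} = ⊤ ↔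
      pairIdeal (D * J) (ψ p.1, ψ p.2) = J := by
    rintro ⟨⟨x⟩, ⟨y⟩⟩
    change Ideal.span {Ideal.Quotient.mk D x, Ideal.Quotient.mk D y} = ⊤ ↔
      pairIdeal (D * J) (ψ (Ideal.Quotient.mk D x), ψ (Ideal.Quotient.mk D y)) = J
    rw [hψ, hψ, pairIdeal_mk, span_pair_mk_eq_top_iff]
    -- Expanding `J = D J + (t)` on the right produces the extra term `(x, y) D J`, which `D J`
    -- absorbs.
    have h1 : D * J ⊔ Ideal.span {t * x, t * y} = (D ⊔ Ideal.span {x, y}) * J := by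
      rw [Ideal.sup_mul]
      nth_rewrite 3 [← ht]
      rw [Ideal.mul_sup, ← sup_assoc, sup_eq_left.2 (Ideal.mul_le_right :
        Ideal.span {x, y} * (D * J) ≤ D * J), mul_comm (Ideal.span {x, y}),
        Ideal.span_mul_span]
      congr 2
      ext z
      simp [eq_comm]
    rw [h1]
    exact ⟨fun h ↦ by rw [h, Ideal.top_mul], fun h ↦ mul_right_cancel₀ hJ (by
      rw [h, Ideal.top_mul])⟩
  have hsurj : ∀ x ∈ J, ∃ z, ψ z = Ideal.Quotient.mk (D * J) x := by
    intro x hx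
    rw [← ht, Submodule.mem_sup] at hx
    obtain ⟨i, hi, j, hj, rfl⟩ := hx
    obtain ⟨z, rfl⟩ := Ideal.mem_span_singleton'.1 hj
    refine ⟨Ideal.Quotient.mk D z, ?_⟩
    rw [hψ, map_add, Ideal.Quotient.eq_zero_iff_mem.2 hi, zero_add, mul_comm t]
  symm
  refine Nat.card_congr (Equiv.ofBijective
    (fun p ↦ ⟨(ψ p.1.1, ψ p.1.2), (hiff p.1).1 p.2⟩) ⟨?_, ?_⟩)
  · rintro ⟨⟨x, y⟩, _⟩ ⟨⟨x', y'⟩, _⟩ h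
    simp only [Subtype.mk.injEq, Prod.mk.injEq] at h
    simp only [Subtype.mk.injEq, Prod.mk.injEq]
    exact ⟨hinj h.1, hinj h.2⟩
  · rintro ⟨⟨⟨x⟩, ⟨y⟩⟩, h⟩
    change pairIdeal (D * J) (Ideal.Quotient.mk _ x, Ideal.Quotient.mk _ y) = J at h
    have h' := h
    rw [pairIdeal_mk] at h'
    obtain ⟨z, hz⟩ := hsurj x (h' ▸ Ideal.mem_sup_right (Ideal.subset_span (by simp)))
    obtain ⟨w, hw⟩ := hsurj y (h' ▸ Ideal.mem_sup_right (Ideal.subset_span (by simp)))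
    refine ⟨⟨(z, w), (hiff _).2 ?_⟩, ?_⟩
    · simp only [hz, hw, h]
    · simp only [hz, hw]
      rfl

end Pairs

/-! ### Dirichlet series over ideals and the telescoping product -/

section IdealSeries

variable {R : Type*} [CommRing R] [IsDedekindDomain R] [Module.Free ℤ R]

/-- The number of solutions of `x c_d(b) = x' c_d(a)` over `R/I`, normalized by the number of
all `(x, x')`. -/
noncomputable def solutionDensity (d : ℕ) (I : Ideal R) : ℚ :=
  (solutionCount (R ⧸ I) d : ℚ) / (Ideal.absNorm I : ℚ) ^ (2 * (d + 1).choose 2)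

theorem solutionDensity_zero (I : Ideal R) : solutionDensity 0 I = 1 := by
  have h : solutionCount (R ⧸ I) 0 = 1 := by
    have : IsEmpty (Fin ((0 + 1).choose 2)) := by simp; infer_instance
    rw [solutionCount, Nat.card_eq_one_iff_unique]
    refine ⟨inferInstance, ⟨⟨0, ?_⟩⟩⟩
    exact Subsingleton.elim _ _
  simp [solutionDensity, h]

variable [Module.Finite ℤ R]

theorem finite_quotient_of_ne_bot {I : Ideal R} (hI : I ≠ ⊥) : Finite (R ⧸ I) := by
  rwa [← Ideal.absNorm_ne_zero_iff, Ne, Ideal.absNorm_eq_zero_iff]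

theorem absNorm_ne_zero_of_ne_bot {I : Ideal R} (hI : I ≠ ⊥) : (Ideal.absNorm I : ℚ) ≠ 0 := by
  rwa [Nat.cast_ne_zero, Ne, Ideal.absNorm_eq_zero_iff]

variable [CharZero R]

/-- The finite set of ideals of norm `n ≠ 0` (with an empty set for `n = 0`). -/
noncomputable def idealsOfNorm (R : Type*) [CommRing R] [IsDedekindDomain R] [Module.Free ℤ R]
    [Module.Finite ℤ R] [CharZero R] (n : ℕ) : Finset (Ideal R) :=
  (((Ideal.finite_setOfPred_absNorm_eq (S := R) n).subset
    (fun _ h ↦ h.1 : {I : Ideal R | Ideal.absNorm I = n ∧ n ≠ 0} ⊆ _))).toFinset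

@[simp]
theorem mem_idealsOfNorm (n : ℕ) (I : Ideal R) :
    I ∈ idealsOfNorm R n ↔ Ideal.absNorm I = n ∧ n ≠ 0 := by
  simp [idealsOfNorm]

theorem finite_setOf_mul_eq (I : Ideal R) :
    {x : Ideal R × Ideal R | x.1 * x.2 = I ∧ I ≠ ⊥}.Finite := by
  refine ((Ideal.finite_setOfPred_absNorm_le (S := R) (Ideal.absNorm I)).prod
    (Ideal.finite_setOfPred_absNorm_le (S := R) (Ideal.absNorm I))).subset ?_
  rintro ⟨D, J⟩ ⟨rfl, hI⟩
  have h0 : 0 < Ideal.absNorm (D * J) := Nat.pos_of_ne_zero (by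
    rwa [Ne, Ideal.absNorm_eq_zero_iff])
  exact ⟨Nat.le_of_dvd h0 (by rw [map_mul]; exact dvd_mul_right _ _),
    Nat.le_of_dvd h0 (by rw [map_mul]; exact dvd_mul_left _ _)⟩

/-- The finite set of factorizations of a nonzero ideal as a product of two ideals. -/
noncomputable def idealAntidiagonal (I : Ideal R) : Finset (Ideal R × Ideal R) :=
  (finite_setOf_mul_eq I).toFinset

@[simp]
theorem mem_idealAntidiagonal (I : Ideal R) (x : Ideal R × Ideal R) :
    x ∈ idealAntidiagonal I ↔ x.1 * x.2 = I ∧ I ≠ ⊥ := by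
  simp [idealAntidiagonal]

/-- The formal Dirichlet series `∑ f(I) N(I)^{-s}`. -/
noncomputable def idealSeries (f : Ideal R → ℚ) : ArithmeticFunction ℚ where
  toFun n := ∑ I ∈ idealsOfNorm R n, f I
  map_zero' := Finset.sum_eq_zero fun I hI ↦ by simp at hI

theorem idealSeries_apply (f : Ideal R → ℚ) (n : ℕ) :
    idealSeries f n = ∑ I ∈ idealsOfNorm R n, f I := rfl

theorem idealSeries_congr {f g : Ideal R → ℚ} (h : ∀ I ≠ ⊥, f I = g I) :
    idealSeries f = idealSeries g := by
  ext n
  refine Finset.sum_congr rfl fun I hI ↦ h I ?_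
  rw [mem_idealsOfNorm] at hI
  rintro rfl
  exact hI.2 (by rw [← hI.1, Ideal.absNorm_bot])

theorem idealSeries_mul (f g : Ideal R → ℚ) :
    idealSeries f * idealSeries g =
      idealSeries fun I ↦ ∑ x ∈ idealAntidiagonal I, f x.1 * g x.2 := by
  ext n
  rw [ArithmeticFunction.mul_apply, idealSeries_apply, Finset.sum_sigma']
  simp only [idealSeries_apply, Finset.sum_mul_sum, ← Finset.sum_product']
  rw [Finset.sum_sigma']
  refine Finset.sum_bij' (fun x _ ↦ ⟨x.2.1 * x.2.2, x.2⟩)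
    (fun y _ ↦ ⟨(Ideal.absNorm y.2.1, Ideal.absNorm y.2.2), y.2⟩) ?_ ?_ ?_ ?_ ?_
  · rintro ⟨⟨m₁, m₂⟩, ⟨D, J⟩⟩ h
    simp only [Finset.mem_sigma, Nat.mem_divisorsAntidiagonal, Finset.mem_product,
      mem_idealsOfNorm, mem_idealAntidiagonal, map_mul] at h ⊢
    obtain ⟨⟨h1, h2⟩, ⟨h3, -⟩, h4, -⟩ := h
    refine ⟨⟨by rw [h3, h4, h1], h2⟩, trivial, ?_⟩
    rw [Ne, ← Ideal.absNorm_eq_zero_iff, map_mul, h3, h4, h1]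
    exact h2
  · rintro ⟨I, ⟨D, J⟩⟩ h
    simp only [Finset.mem_sigma, Nat.mem_divisorsAntidiagonal, Finset.mem_product,
      mem_idealsOfNorm, mem_idealAntidiagonal] at h ⊢
    obtain ⟨⟨h1, h2⟩, rfl, -⟩ := h
    rw [map_mul] at h1
    refine ⟨⟨h1, h2⟩, ⟨trivial, ?_⟩, trivial, ?_⟩
    · rintro h0; exact h2 (by rw [← h1, h0, zero_mul])
    · rintro h0; exact h2 (by rw [← h1, h0, mul_zero])
  · rintro ⟨⟨m₁, m₂⟩, ⟨D, J⟩⟩ h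
    simp only [Finset.mem_sigma, Finset.mem_product, mem_idealsOfNorm] at h
    obtain ⟨-, ⟨rfl, -⟩, rfl, -⟩ := h
    rfl
  · rintro ⟨I, ⟨D, J⟩⟩ h
    simp only [Finset.mem_sigma, mem_idealAntidiagonal] at h
    obtain ⟨-, rfl, -⟩ := h
    rfl
  · intros; rfl

/-- To contain is to divide, so each pair determines a factorization `I = D J` with `J` its ideal;
the fibres are counted by `card_pairIdeal_eq`. -/
theorem sum_pairIdeal (I : Ideal R) (hI : I ≠ ⊥) [Fintype (R ⧸ I)] (F : Ideal R → ℚ) :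
    ∑ p : (R ⧸ I) × (R ⧸ I), F (pairIdeal I p) =
      ∑ x ∈ idealAntidiagonal I, (unimodularPairs x.1 : ℚ) * F x.2 := by
  classical
  have h1 : ∀ p, ∃ D, D * pairIdeal I p = I := fun p ↦ by
    obtain ⟨D, hD⟩ := Ideal.dvd_iff_le.2 (le_pairIdeal I p)
    exact ⟨D, by rw [mul_comm, ← hD]⟩
  choose D hD using h1
  rw [← Finset.sum_fiberwise_of_maps_to (s := Finset.univ) (t := idealAntidiagonal I)
    (g := fun p ↦ (D p, pairIdeal I p)) (fun p _ ↦ by simp [hD, hI])]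
  refine Finset.sum_congr rfl fun x hx ↦ ?_
  rw [mem_idealAntidiagonal] at hx
  obtain ⟨⟨E, J⟩, rfl⟩ : ∃ y, y = x := ⟨x, rfl⟩
  obtain ⟨rfl, -⟩ := hx
  have h2 : ∀ p, (D p, pairIdeal (E * J) p) = (E, J) ↔ pairIdeal (E * J) p = J := by
    intro p
    refine ⟨fun h ↦ (Prod.ext_iff.1 h).2, fun h ↦ Prod.ext ?_ h⟩
    have h3 := hD p
    rw [h] at h3
    exact mul_right_cancel₀ (by rintro rfl; simp at hI) h3
  rw [← card_pairIdeal_eq E J hI, Nat.card_eq_fintype_card, Fintype.card_subtype,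
    Finset.sum_congr rfl (g := fun _ ↦ F J), Finset.sum_const, nsmul_eq_mul]
  · simp only [h2]
  · intro p hp
    rw [Finset.mem_filter, h2] at hp
    rw [hp.2]

/-- With `N = N(I)` and `M = N(J)`, the powers in `headCount_mul` collapse to `(N/M)^(d-1) =
N(D)^(d-1)` after normalization. The exponent is an integer since it is `-1` for `d = 0`. -/
theorem solutionDensity_succ (d : ℕ) (I : Ideal R) (hI : I ≠ ⊥) :
    solutionDensity (d + 1) I = ∑ x ∈ idealAntidiagonal I,
      ((unimodularPairs x.1 : ℚ) * (Ideal.absNorm x.1 : ℚ) ^ ((d : ℤ) - 1)) *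
        solutionDensity d x.2 := by
  have := finite_quotient_of_ne_bot hI
  have := Fintype.ofFinite (R ⧸ I)
  have hN := absNorm_ne_zero_of_ne_bot hI
  set N : ℚ := (Ideal.absNorm I : ℚ) with hNdef
  have key : ∀ p : (R ⧸ I) × (R ⧸ I),
      (headCount (R ⧸ I) d p : ℚ) / N ^ (2 * (d + 1 + 1).choose 2) =
        (N / (Ideal.absNorm (pairIdeal I p) : ℚ)) ^ ((d : ℤ) - 1) *
          solutionDensity d (pairIdeal I p) := by
    intro p
    have hJ : pairIdeal I p ≠ ⊥ := fun h ↦ hI (le_bot_iff.1 (h ▸ le_pairIdeal I p))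
    have := finite_quotient_of_ne_bot hJ
    have h := headCount_mul d p (Ideal.Quotient.factor (le_pairIdeal I p))
      (Ideal.Quotient.factor_surjective _) (ker_factor_pairIdeal I p)
    have hM := absNorm_ne_zero_of_ne_bot hJ
    rw [solutionDensity]
    set M : ℚ := (Ideal.absNorm (pairIdeal I p) : ℚ) with hMdef
    have h' : (headCount (R ⧸ I) d p : ℚ) * M ^ (2 * d + 2 * (d + 1).choose 2) =
        (N * M) ^ (d + 1) * N ^ (2 * d + 2 * (d + 1).choose 2) *
          (solutionCount (R ⧸ pairIdeal I p) d : ℚ) := by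
      rw [hNdef, hMdef]
      exact_mod_cast h
    rw [← rows_succ, zpow_sub_one₀ (div_ne_zero hN hM), zpow_natCast,
      eq_div_of_mul_eq (pow_ne_zero _ hM) h']
    generalize (d + 1).choose 2 = C
    simp only [mul_add, pow_add, mul_pow, div_pow, two_mul, pow_one]
    field_simp
  have h1 := sum_pairIdeal I hI
    (fun J ↦ (N / (Ideal.absNorm J : ℚ)) ^ ((d : ℤ) - 1) * solutionDensity d J)
  rw [solutionDensity, solutionCount_succ, Nat.cast_sum, Finset.sum_div,
    Finset.sum_congr rfl fun p _ ↦ key p, h1]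
  refine Finset.sum_congr rfl fun x hx ↦ ?_
  rw [mem_idealAntidiagonal] at hx
  have hx2 : (Ideal.absNorm x.2 : ℚ) ≠ 0 := absNorm_ne_zero_of_ne_bot (by
    rintro h; exact hx.2 (by rw [← hx.1, h]; simp))
  rw [hNdef, ← hx.1, map_mul, Nat.cast_mul, mul_div_cancel_right₀ _ hx2, mul_assoc]

theorem sum_unimodularPairs (I : Ideal R) (hI : I ≠ ⊥) :
    ∑ x ∈ idealAntidiagonal I, (unimodularPairs x.1 : ℚ) = (Ideal.absNorm I : ℚ) ^ 2 := by
  have := finite_quotient_of_ne_bot hI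
  have := Fintype.ofFinite (R ⧸ I)
  have h := sum_pairIdeal I hI fun _ ↦ 1
  simp only [mul_one, Finset.sum_const, Finset.card_univ, Fintype.card_prod, nsmul_eq_mul] at h
  rw [← h, Ideal.absNorm_apply, Submodule.cardQuot_apply, Nat.card_eq_fintype_card]
  push_cast
  ring

variable (R) in
/-- The shifted zeta function of `R` as a formal Dirichlet series. -/
noncomputable def shiftedZeta (c : ℤ) : ArithmeticFunction ℚ :=
  idealSeries fun I : Ideal R ↦ (Ideal.absNorm I : ℚ) ^ c

theorem isUnit_shiftedZeta (c : ℤ) : IsUnit (shiftedZeta R c) := by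
  rw [ArithmeticFunction.isUnit_iff_isUnit_apply_one, isUnit_iff_ne_zero, shiftedZeta,
    idealSeries_apply]
  have h : idealsOfNorm R 1 = {⊤} := by ext I; simp
  simp [h]

theorem unimodularPairs_mul_shiftedZeta (c : ℤ) :
    idealSeries (fun I : Ideal R ↦ (unimodularPairs I : ℚ) * (Ideal.absNorm I : ℚ) ^ c) *
      shiftedZeta R c = shiftedZeta R (c + 2) := by
  rw [shiftedZeta, idealSeries_mul]
  refine idealSeries_congr fun I hI ↦ ?_
  rw [zpow_add₀ (absNorm_ne_zero_of_ne_bot hI), show (2 : ℤ) = ((2 : ℕ) : ℤ) from rfl, zpow_natCast,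
    ← sum_unimodularPairs I hI, Finset.mul_sum]
  refine Finset.sum_congr rfl fun x hx ↦ ?_
  rw [mem_idealAntidiagonal] at hx
  rw [← hx.1, map_mul, Nat.cast_mul, mul_zpow]
  ring

/-- Passing from `d` to `d + 1` multiplies the series by `ζ(s-c-d-1)/ζ(s-c-d+1)`. Starting from
`ζ(s-c)`, all but two numerators and one denominator cancel. -/
theorem solutionDensity_mul_shiftedZeta (d : ℕ) (c : ℤ) :
    idealSeries (fun I : Ideal R ↦ solutionDensity d I * (Ideal.absNorm I : ℚ) ^ c) *
      shiftedZeta R (c - 1) = shiftedZeta R (c + d) * shiftedZeta R (c + d - 1) := by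
  induction d with
  | zero => simp [solutionDensity_zero, shiftedZeta]
  | succ d ih =>
    have h1 : idealSeries (fun I : Ideal R ↦
        solutionDensity (d + 1) I * (Ideal.absNorm I : ℚ) ^ c) =
        idealSeries (fun I : Ideal R ↦
          (unimodularPairs I : ℚ) * (Ideal.absNorm I : ℚ) ^ (c + d - 1)) *
        idealSeries (fun I : Ideal R ↦ solutionDensity d I * (Ideal.absNorm I : ℚ) ^ c) := by
      rw [idealSeries_mul]
      refine idealSeries_congr fun I hI ↦ ?_
      rw [solutionDensity_succ d I hI, Finset.sum_mul]
      refine Finset.sum_congr rfl fun x hx ↦ ?_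
      rw [mem_idealAntidiagonal] at hx
      have hx1 : (Ideal.absNorm x.1 : ℚ) ≠ 0 := absNorm_ne_zero_of_ne_bot (by
        rintro h; exact hx.2 (by rw [← hx.1, h]; simp))
      rw [← hx.1, map_mul, Nat.cast_mul, mul_zpow, add_sub_assoc, zpow_add₀ hx1]
      ring
    have h2 := unimodularPairs_mul_shiftedZeta (R := R) (c + d - 1)
    apply (isUnit_shiftedZeta (R := R) (c + d - 1)).mul_right_cancel
    rw [h1]
    have e1 : c + ((d + 1 : ℕ) : ℤ) = c + d - 1 + 2 := by push_cast; ring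
    have e2 : c + d - 1 + 2 - 1 = c + d := by ring
    rw [e1, e2, ← h2]
    linear_combination (idealSeries (fun I : Ideal R ↦
          (unimodularPairs I : ℚ) * (Ideal.absNorm I : ℚ) ^ (c + d - 1)) *
          shiftedZeta R (c + d - 1)) * ih

end IdealSeries

/-! ### Nonvanishing of sums of completely multiplicative functions on ideals -/

section Nonvanishing

variable {R : Type*} [CommRing R]

open Classical in
/-- The restriction of a function to the ideals not divisible by any member of `P`. -/
noncomputable def sieve (a : Ideal R → ℂ) (P : Finset (Ideal R)) (I : Ideal R) : ℂ :=
  if ∀ p ∈ P, ¬ p ∣ I then a I else 0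

theorem summable_sieve {a : Ideal R → ℂ} (ha : Summable fun I ↦ ‖a I‖) (P : Finset (Ideal R)) :
    Summable (sieve a P) := by
  refine Summable.of_norm_bounded ha fun I ↦ ?_
  rw [sieve]
  split_ifs <;> simp

variable [IsDedekindDomain R]

/-- Sieving by `p` removes the multiples `p J`. As `p` is coprime to the primes in `P`, these
contribute `a p` times the old sum. -/
theorem tsum_sieve_insert [DecidableEq (Ideal R)] (a : Ideal R →*₀ ℂ)
    (ha : Summable fun I ↦ ‖a I‖) (P : Finset (Ideal R)) (p : Ideal R) (hp : Prime p)
    (hP : ∀ q ∈ P, Prime q) (hpP : p ∉ P) :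
    ∑' I, sieve a (insert p P) I = (1 - a p) * ∑' I, sieve a P I := by
  classical
  have hinj : Function.Injective fun J : Ideal R ↦ p * J := mul_right_injective₀ hp.ne_zero
  have h1 : ∀ J, sieve a P (p * J) = a p * sieve a P J := by
    intro J
    have : (∀ q ∈ P, ¬ q ∣ p * J) ↔ ∀ q ∈ P, ¬ q ∣ J := by
      refine forall₂_congr fun q hq ↦ not_congr ⟨fun h ↦ ?_, fun h ↦ h.mul_left p⟩
      refine ((hP q hq).dvd_or_dvd h).resolve_left fun h' ↦ hpP ?_
      rwa [← associated_iff_eq.1 ((hP q hq).associated_of_dvd hp h')]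
    simp only [sieve, this]
    split_ifs <;> simp
  have h2 : ∑' I, (if p ∣ I then sieve a P I else 0) = a p * ∑' I, sieve a P I := by
    rw [← tsum_mul_left, ← hinj.tsum_eq]
    · simp [h1]
    · intro I hI
      rw [Function.mem_support] at hI
      obtain ⟨J, rfl⟩ : p ∣ I := by
        by_contra h
        simp [h] at hI
      exact ⟨J, rfl⟩
  have h3 : ∀ I, sieve a (insert p P) I = sieve a P I - if p ∣ I then sieve a P I else 0 := by
    intro I
    simp only [sieve, Finset.forall_mem_insert]
    split_ifs <;> simp_all
  have h4 : Summable fun I ↦ if p ∣ I then sieve a P I else 0 := by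
    refine Summable.of_norm_bounded (summable_sieve ha P).norm fun I ↦ ?_
    split_ifs <;> simp
  simp only [h3]
  rw [(summable_sieve ha P).tsum_sub h4, h2]
  ring

/-- The sum of an absolutely summable completely multiplicative function on ideals is nonzero. -/
theorem tsum_ideal_ne_zero (a : Ideal R →*₀ ℂ) (ha : Summable fun I ↦ ‖a I‖) :
    ∑' I, a I ≠ 0 := by
  classical
  have h1 : ∀ P : Finset (Ideal R), (∀ q ∈ P, Prime q) →
      ∑' I, sieve a P I = (∏ p ∈ P, (1 - a p)) * ∑' I, a I := by
    intro P
    induction P using Finset.induction_on with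
    | empty => simp [sieve]
    | insert p P hp ih =>
      intro h
      rw [Finset.forall_mem_insert] at h
      rw [tsum_sieve_insert a ha P p h.1 h.2 hp, ih h.2, Finset.prod_insert hp, mul_assoc]
  -- Outside `F` the norms sum to less than `1`. Sieving by one prime divisor of each nonzero
  -- nonunit in `F` leaves the term `1` of the unit ideal and a remainder of norm below `1`. If the
  -- full sum were zero, so would be the sieved one, forcing the remainder to be `-1`.
  obtain ⟨F, hF⟩ := ((tendsto_tsum_compl_atTop_zero fun I ↦ ‖a I‖).eventually
    (gt_mem_nhds one_pos)).exists
  have h2 : ∀ I : Ideal R, ∃ p : Ideal R, I ≠ 0 → ¬ IsUnit I → Prime p ∧ p ∣ I := by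
    intro I
    by_cases h : I ≠ 0 ∧ ¬ IsUnit I
    · obtain ⟨p, hp, hpI⟩ := WfDvdMonoid.exists_irreducible_factor h.2 h.1
      exact ⟨p, fun _ _ ↦ ⟨hp.prime, hpI⟩⟩
    · exact ⟨0, fun h1 h2 ↦ (h ⟨h1, h2⟩).elim⟩
  choose π hπ using h2
  let P : Finset (Ideal R) := (F.filter fun I ↦ I ≠ 0 ∧ ¬ IsUnit I).image π
  have hP : ∀ q ∈ P, Prime q := by
    intro q hq
    simp only [P, Finset.mem_image, Finset.mem_filter] at hq
    obtain ⟨I, ⟨-, h1, h2⟩, rfl⟩ := hq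
    exact (hπ I h1 h2).1
  intro h0
  have h3 := h1 P hP
  rw [h0, mul_zero] at h3
  have hs1 : sieve a P 1 = 1 := by
    rw [sieve, if_pos, map_one]
    exact fun p hp h ↦ (hP p hp).not_isUnit (isUnit_of_dvd_one h)
  have h4 := (summable_sieve ha P).tsum_eq_add_tsum_ite 1
  rw [h3, hs1] at h4
  have hle : ∀ I, ‖if I = 1 then 0 else sieve a P I‖ ≤
      Set.indicator ((F : Set (Ideal R))ᶜ) (fun I ↦ ‖a I‖) I := by
    intro I
    by_cases hI : I ∈ F
    · rw [Set.indicator_of_notMem (by simpa using hI), norm_le_zero_iff]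
      split_ifs with hI1
      · rfl
      · rw [sieve]
        split_ifs with h
        · by_cases hI0 : I = 0
          · rw [hI0, map_zero]
          · have hu : ¬ IsUnit I := by rwa [Ideal.isUnit_iff, ← Ideal.one_eq_top]
            exact (h (π I) (Finset.mem_image_of_mem _ (Finset.mem_filter.2 ⟨hI, hI0, hu⟩))
              (hπ I hI0 hu).2).elim
        · rfl
    · rw [Set.indicator_of_mem (by simpa using hI), sieve]
      split_ifs <;> simp
  have hsum := ha.indicator ((F : Set (Ideal R))ᶜ)
  have h5 : ‖∑' I, if I = 1 then 0 else sieve a P I‖ ≤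
      ∑' I, Set.indicator ((F : Set (Ideal R))ᶜ) (fun I ↦ ‖a I‖) I :=
    tsum_of_norm_bounded hsum.hasSum hle
  rw [← tsum_subtype] at h5
  have h6 : ∑' I, (if I = 1 then 0 else sieve a P I) = -1 := by linear_combination -h4
  rw [h6, norm_neg, norm_one] at h5
  exact absurd hF (not_lt.2 h5)

end Nonvanishing

/-! ### Summation over ideals versus summation over norms -/

section Convergence

variable {R : Type*} [CommRing R] [IsDedekindDomain R] [Module.Free ℤ R] [Module.Finite ℤ R]
  [CharZero R]

/-- The ideals of finite index, sorted by their norms. -/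
noncomputable def sigmaIdealsOfNorm :
    (Σ n : ℕ, idealsOfNorm R n) ≃ {I : Ideal R // Finite (R ⧸ I)} where
  toFun x := ⟨x.2.1, by
    have h := (mem_idealsOfNorm _ _).1 x.2.2
    rw [← Ideal.absNorm_ne_zero_iff, h.1]
    exact h.2⟩
  invFun I := ⟨Ideal.absNorm I.1, I.1, (mem_idealsOfNorm _ _).2
    ⟨rfl, (Ideal.absNorm_ne_zero_iff _).2 I.2⟩⟩
  left_inv := by
    rintro ⟨n, I, hI⟩
    obtain ⟨rfl, -⟩ := (mem_idealsOfNorm _ _).1 hI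
    rfl
  right_inv _ := rfl

/-- For `f ≥ 0` there is no cancellation among ideals of equal norm, so absolute convergence of the
series over `n` gives it over ideals. -/
theorem hasSum_idealSeries {f : Ideal R → ℚ} (hf : ∀ I, 0 ≤ f I) {s : ℂ}
    (hs : LSeriesSummable (fun n ↦ (idealSeries f n : ℂ)) s) :
    HasSum (fun I : {I : Ideal R // Finite (R ⧸ I)} ↦
      (f I.1 : ℂ) * (Ideal.absNorm I.1 : ℂ) ^ (-s))
      (LSeries (fun n ↦ (idealSeries f n : ℂ)) s) := by
  rw [← sigmaIdealsOfNorm.hasSum_iff]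
  set F : (Σ n : ℕ, idealsOfNorm R n) → ℂ := (fun I : {I : Ideal R // Finite (R ⧸ I)} ↦
      (f I.1 : ℂ) * (Ideal.absNorm I.1 : ℂ) ^ (-s)) ∘ sigmaIdealsOfNorm with hF
  have hFn : ∀ n (I : idealsOfNorm R n), F ⟨n, I⟩ = (f I.1 : ℂ) * (n : ℂ) ^ (-s) := by
    rintro n ⟨I, hI⟩
    obtain ⟨rfl, -⟩ := (mem_idealsOfNorm _ _).1 hI
    rfl
  have hfib : ∀ n, HasSum (fun I ↦ F ⟨n, I⟩)
      (LSeries.term (fun n ↦ (idealSeries f n : ℂ)) s n) := by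
    intro n
    rw [LSeries.term_def₀ (by simp)]
    simp only [hFn]
    have h := hasSum_fintype fun I : idealsOfNorm R n ↦ (f I.1 : ℂ) * (n : ℂ) ^ (-s)
    rwa [← Finset.sum_mul, Finset.sum_coe_sort (idealsOfNorm R n) (fun I ↦ (f I : ℂ)),
      ← Rat.cast_sum] at h
  have hsum : Summable F := by
    rw [← summable_norm_iff, summable_sigma_of_nonneg fun _ ↦ norm_nonneg _]
    refine ⟨fun n ↦ .of_finite, ?_⟩
    refine hs.norm.congr fun n ↦ ?_
    rw [LSeries.term_def₀ (by simp), tsum_fintype]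
    simp only [hFn, norm_mul]
    rw [← Finset.sum_mul, Finset.sum_coe_sort (idealsOfNorm R n) (fun I ↦ ‖(f I : ℂ)‖)]
    congr 1
    rw [idealSeries_apply, Complex.norm_ratCast, abs_of_nonneg (by
      exact_mod_cast Finset.sum_nonneg fun I _ ↦ hf I), Rat.cast_sum]
    refine Finset.sum_congr rfl fun I _ ↦ ?_
    rw [Complex.norm_ratCast, abs_of_nonneg (by exact_mod_cast hf I)]
  have h := hsum.hasSum.sigma hfib
  rw [LSeries, h.tsum_eq]
  exact hsum.hasSum

theorem cast_mul_eq_convolution (f g : ArithmeticFunction ℚ) :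
    (fun n ↦ ((f * g) n : ℂ)) = LSeries.convolution (fun n ↦ (f n : ℂ)) (fun n ↦ (g n : ℂ)) := by
  rw [LSeries.convolution_def]
  ext n
  simp [ArithmeticFunction.mul_apply]

end Convergence

/-! ### Dedekind zeta functions: convergence, shifts, nonvanishing -/

section DedekindZeta

open NumberField Filter Topology Asymptotics

variable (k : Type*) [Field k] [NumberField k]

theorem dedekindZetaFormal_eq (c : ℤ) : dedekindZetaFormal k c = shiftedZeta (𝓞 k) c := by
  ext n
  change (if n = 0 then 0 else _) = _
  rw [shiftedZeta, idealSeries_apply]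
  split_ifs with hn
  · subst hn
    exact (Finset.sum_eq_zero fun I hI ↦ by simp at hI).symm
  · have h : Nat.card {I : Ideal (𝓞 k) // Ideal.absNorm I = n} = (idealsOfNorm (𝓞 k) n).card :=
      Nat.subtype_card _ fun I ↦ by simp [hn]
    rw [h, Finset.sum_congr rfl (g := fun _ ↦ (n : ℚ) ^ c), Finset.sum_const, nsmul_eq_mul]
    intro I hI
    rw [((mem_idealsOfNorm _ _).1 hI).1]

/-- The number of nonzero ideals of norm at most `n` is asymptotically the residue times `n`, so the
partial sums of the coefficients are `O(n)`. -/
theorem lseriesSummable_dedekindZeta {s : ℂ} (hs : 1 < s.re) :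
    LSeriesSummable (fun n ↦ (Nat.card {I : Ideal (𝓞 k) // Ideal.absNorm I = n} : ℂ)) s := by
  have h1 := LSeriesSummable_of_sum_norm_bigO_and_nonneg (r := 1) (s := s)
    (f := fun n ↦ (Nat.card {I : Ideal (𝓞 k) // Ideal.absNorm I = n} : ℝ)) ?_
    (fun _ ↦ Nat.cast_nonneg _) zero_le_one hs
  · simpa using h1
  refine isBigO_atTop_natCast_rpow_of_tendsto_div_rpow
    (a := dedekindZeta_residue k) ?_
  simp only [Real.rpow_one]
  refine ((Ideal.tendsto_norm_le_div_atTop₀ k).comp tendsto_natCast_atTop_atTop).congr fun n ↦ ?_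
  simp only [Function.comp_apply, Nat.cast_le, ← Nat.cast_sum]
  congr
  -- The added `1` accounts for the zero ideal, the only one of norm `0`, so that all ideals of norm
  -- at most `n` are counted.
  rw [← add_left_inj 1, ← Ideal.card_norm_le_eq_card_norm_le_add_one,
    show Finset.Icc 1 n = Finset.Ioc 0 n from Finset.Icc_succ_left_eq_Ioc _ _,
    show 1 = Nat.card {I : Ideal (𝓞 k) // Ideal.absNorm I = 0} by simp [Ideal.absNorm_eq_zero_iff],
    Finset.sum_Ioc_add_eq_sum_Icc (n.zero_le),
    ← Finset.card_preimage_eq_sum_card_image_eq (fun k _ ↦ Ideal.finite_setOfPred_absNorm_eq k)]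
  simp [Set.coe_eq_subtype]

theorem term_shiftedZeta (c : ℤ) (s : ℂ) (n : ℕ) :
    LSeries.term (fun n ↦ (shiftedZeta (𝓞 k) c n : ℂ)) s n =
      LSeries.term (fun n ↦ (Nat.card {I : Ideal (𝓞 k) // Ideal.absNorm I = n} : ℂ))
        (s - c) n := by
  rcases eq_or_ne n 0 with rfl | hn
  · simp
  rw [← dedekindZetaFormal_eq, LSeries.term_of_ne_zero hn, LSeries.term_of_ne_zero hn]
  have h : dedekindZetaFormal k c n =
    (Nat.card {I : Ideal (𝓞 k) // Ideal.absNorm I = n} : ℚ) * (n : ℚ) ^ c := if_neg hn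
  rw [h, Complex.cpow_sub _ _ (Nat.cast_ne_zero.2 hn), Complex.cpow_intCast]
  push_cast
  rw [div_div_eq_mul_div]

theorem lseriesSummable_shiftedZeta {c : ℤ} {s : ℂ} (hs : 1 + c < s.re) :
    LSeriesSummable (fun n ↦ (shiftedZeta (𝓞 k) c n : ℂ)) s := by
  rw [LSeriesSummable, funext (term_shiftedZeta k c s)]
  exact lseriesSummable_dedekindZeta k (by simp; linarith)

theorem lseries_shiftedZeta (c : ℤ) (s : ℂ) :
    LSeries (fun n ↦ (shiftedZeta (𝓞 k) c n : ℂ)) s = dedekindZeta k (s - c) :=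
  tsum_congr (term_shiftedZeta k c s)

theorem dedekindZeta_ne_zero {s : ℂ} (hs : 1 < s.re) : dedekindZeta k s ≠ 0 := by
  -- Needed because `0 ^ 0 = 1`: the zero ideal must be sent to `0`.
  have hs0 : -s ≠ 0 := by
    rintro h
    rw [neg_eq_zero] at h
    simp [h] at hs
    linarith
  let a : Ideal (𝓞 k) →*₀ ℂ :=
    { toFun := fun I ↦ (Ideal.absNorm I : ℂ) ^ (-s)
      map_zero' := by simp [Complex.zero_cpow hs0]
      map_one' := by simp
      map_mul' := fun I J ↦ by rw [map_mul, Nat.cast_mul, Complex.natCast_mul_natCast_cpow] }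
  have h := hasSum_idealSeries (R := 𝓞 k) (f := fun I ↦ (Ideal.absNorm I : ℚ) ^ (0 : ℤ)) (s := s)
    (fun I ↦ by positivity) (lseriesSummable_shiftedZeta k (c := 0) (by simpa using hs))
  have h' := lseries_shiftedZeta k 0 s
  rw [shiftedZeta] at h'
  rw [h'] at h
  simp only [zpow_zero, Rat.cast_one, one_mul, Int.cast_zero, sub_zero] at h
  have h2 : HasSum a (dedekindZeta k s) := by
    refine (hasSum_subtype_iff_of_support_subset (s := {I : Ideal (𝓞 k) | Finite (𝓞 k ⧸ I)})
      ?_).1 h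
    intro I hI
    change Finite (𝓞 k ⧸ I)
    rw [← Ideal.absNorm_ne_zero_iff, Ne, Ideal.absNorm_eq_zero_iff]
    rintro rfl
    exact hI a.map_zero'
  rw [← h2.tsum_eq]
  exact tsum_ideal_ne_zero a h2.summable.norm

end DedekindZeta

/-! ### The conjugacy class zeta function -/

section Main

open NumberField

variable (k : Type u) [Field k] [NumberField k]

theorem quotientClassNumber_eq (d : ℕ) (I : Ideal (𝓞 k)) [Finite (𝓞 k ⧸ I)] :
    (quotientClassNumber (gammaGroup k d) I : ℚ) =
      solutionDensity d I * (Ideal.absNorm I : ℚ) ^ (((d + 1).choose 2 : ℕ) : ℤ) := by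
  have h := quotientClassNumber_gammaGroup_mul k d I
  have hN : (Ideal.absNorm I : ℚ) ≠ 0 := by
    rw [Nat.cast_ne_zero]; exact (Ideal.absNorm_ne_zero_iff I).2 inferInstance
  rw [solutionDensity, ← h, Nat.cast_mul, Nat.cast_pow, ← Submodule.cardQuot_apply,
    ← Ideal.absNorm_apply, zpow_natCast, two_mul, pow_add]
  field_simp

theorem ccZetaFormal_gammaGroup (d : ℕ) :
    ccZetaFormal (gammaGroup k d) = idealSeries (fun I : Ideal (𝓞 k) ↦
      solutionDensity d I * (Ideal.absNorm I : ℚ) ^ (((d + 1).choose 2 : ℕ) : ℤ)) := by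
  ext n
  change (if n = 0 then 0 else _) = _
  rw [idealSeries_apply]
  split_ifs with hn
  · subst hn
    exact (Finset.sum_eq_zero fun I hI ↦ by simp at hI).symm
  · have hset : {I : Ideal (𝓞 k) | Nat.card (𝓞 k ⧸ I) = n} = ↑(idealsOfNorm (𝓞 k) n) := by
      ext I
      simp [hn, Ideal.absNorm_apply, Submodule.cardQuot_apply]
    have h1 := finsum_set_coe_eq_finsum_mem {I : Ideal (𝓞 k) | Nat.card (𝓞 k ⧸ I) = n}
      (f := fun I : Ideal (𝓞 k) ↦ (quotientClassNumber (gammaGroup k d) I : ℚ))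
    refine h1.trans ?_
    rw [hset, finsum_mem_coe_finset]
    refine Finset.sum_congr rfl fun I hI ↦ ?_
    rw [mem_idealsOfNorm] at hI
    have : Finite (𝓞 k ⧸ I) := (Ideal.absNorm_ne_zero_iff I).1 (by rw [hI.1]; exact hI.2)
    exact quotientClassNumber_eq k d I

theorem solutionDensity_nonneg (d : ℕ) (I : Ideal (𝓞 k)) : 0 ≤ solutionDensity d I := by
  rw [solutionDensity]; positivity

theorem hasSum_ccZetaTerm (d : ℕ) {s : ℂ} (hs : ((d + 1).choose 2 : ℝ) + d + 1 < s.re) :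
    HasSum (ccZetaTerm (gammaGroup k d) s)
      (dedekindZeta k (s - ((d + 1).choose 2 : ℂ) - d) *
        dedekindZeta k (s - ((d + 1).choose 2 : ℂ) - d + 1) /
          dedekindZeta k (s - ((d + 1).choose 2 : ℂ) + 1)) := by
  set C := (d + 1).choose 2 with hC
  set f : ArithmeticFunction ℚ := idealSeries (fun I : Ideal (𝓞 k) ↦
      solutionDensity d I * (Ideal.absNorm I : ℚ) ^ ((C : ℕ) : ℤ)) with hf
  have hf0 : ∀ I : Ideal (𝓞 k),
      0 ≤ solutionDensity d I * (Ideal.absNorm I : ℚ) ^ ((C : ℕ) : ℤ) := fun I ↦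
    mul_nonneg (solutionDensity_nonneg k d I) (by positivity)
  have hd : (0 : ℝ) ≤ d := Nat.cast_nonneg d
  have hid := solutionDensity_mul_shiftedZeta (R := 𝓞 k) d C
  rw [← hf] at hid
  have hs1 := lseriesSummable_shiftedZeta k (c := C + d) (s := s) (by push_cast; linarith)
  have hs2 := lseriesSummable_shiftedZeta k (c := C + d - 1) (s := s) (by push_cast; linarith)
  have hs3 := lseriesSummable_shiftedZeta k (c := C - 1) (s := s) (by push_cast; linarith)
  have hne : dedekindZeta k (s - ((C : ℤ) - 1 : ℤ)) ≠ 0 :=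
    dedekindZeta_ne_zero k (by simp; linarith)
  -- Dividing by zeta does not by itself give convergence. Instead, all coefficients are nonnegative
  -- and `shiftedZeta` has coefficient `1` at `1`, so `f` is bounded termwise by its product with
  -- `shiftedZeta`, which is the convergent numerator.
  have hsf : LSeriesSummable (fun n ↦ (f n : ℂ)) s := by
    have h := hs1.convolution hs2
    rw [← cast_mul_eq_convolution, ← hid] at h
    refine Summable.of_norm_bounded h.norm fun n ↦ LSeries.norm_term_le s ?_
    have hf' : ∀ n, 0 ≤ f n := fun n ↦ Finset.sum_nonneg fun I _ ↦ hf0 I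
    have hz : ∀ n, 0 ≤ shiftedZeta (𝓞 k) (C - 1) n := fun n ↦
      Finset.sum_nonneg fun I _ ↦ by positivity
    have hz1 : shiftedZeta (𝓞 k) (C - 1) 1 = 1 := by
      have h : idealsOfNorm (𝓞 k) 1 = {⊤} := by ext I; simp
      rw [shiftedZeta, idealSeries_apply, h]
      simp
    have hle : f n ≤ (f * shiftedZeta (𝓞 k) (C - 1)) n := by
      rcases eq_or_ne n 0 with rfl | hn
      · simp
      rw [ArithmeticFunction.mul_apply]
      refine le_trans ?_ (Finset.single_le_sum (f := fun x : ℕ × ℕ ↦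
        f x.1 * shiftedZeta (𝓞 k) (C - 1) x.2) (fun x _ ↦ mul_nonneg (hf' _) (hz _))
        (show (n, 1) ∈ n.divisorsAntidiagonal by simp [hn]))
      simp [hz1]
    rw [Complex.norm_ratCast, Complex.norm_ratCast]
    exact abs_le_abs_of_nonneg (by exact_mod_cast hf' n) (by exact_mod_cast hle)
  have hmul := LSeries_convolution' hsf hs3
  rw [← cast_mul_eq_convolution, hid, cast_mul_eq_convolution, LSeries_convolution' hs1 hs2,
    lseries_shiftedZeta, lseries_shiftedZeta, lseries_shiftedZeta] at hmul
  have e1 : s - ((C : ℤ) + d : ℤ) = s - C - d := by push_cast; ring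
  have e2 : s - ((C : ℤ) + d - 1 : ℤ) = s - C - d + 1 := by push_cast; ring
  have e3 : s - ((C : ℤ) - 1 : ℤ) = s - C + 1 := by push_cast; ring
  rw [e1, e2, e3] at hmul
  rw [e3] at hne
  rw [hmul, mul_div_cancel_right₀ _ hne]
  convert hasSum_idealSeries hf0 hsf using 2 with I
  have := I.2
  rw [← quotientClassNumber_eq, Rat.cast_natCast]
  rfl

end Main

end AskZeta

/-- The conjugacy class zeta function of the group functor attached to `γ_d` over `𝔬` equals
`ζ_k(s - C - d) ζ_k(s - C - d + 1) / ζ_k(s - C + 1)` with `C = (d + 1).choose 2`: as an identity of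
formal Dirichlet series, the denominator being invertible, and as an identity of complex numbers
for all `s` in the half-plane `Re s > C + d + 1`, where the series converges absolutely. -/
theorem proposition6p11 (k : Type*) [Field k] [NumberField k] (d : ℕ) :
    (∀ I : Ideal (NumberField.RingOfIntegers k), Finite (NumberField.RingOfIntegers k ⧸ I) →
      Finite ((AskZeta.gammaGroup k d).obj
        (CommAlgCat.of (NumberField.RingOfIntegers k) (NumberField.RingOfIntegers k ⧸ I)))) ∧
    (IsUnit (AskZeta.dedekindZetaFormal k (((d + 1).choose 2 : ℤ) - 1)) ∧
      AskZeta.ccZetaFormal (AskZeta.gammaGroup k d) *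
          AskZeta.dedekindZetaFormal k (((d + 1).choose 2 : ℤ) - 1) =
        AskZeta.dedekindZetaFormal k (((d + 1).choose 2 : ℤ) + d) *
          AskZeta.dedekindZetaFormal k (((d + 1).choose 2 : ℤ) + d - 1)) ∧
    ∀ s : ℂ, ((d + 1).choose 2 : ℝ) + d + 1 < s.re →
      NumberField.dedekindZeta k (s - ((d + 1).choose 2 : ℂ) + 1) ≠ 0 ∧
      HasSum (AskZeta.ccZetaTerm (AskZeta.gammaGroup k d) s)
        (NumberField.dedekindZeta k (s - ((d + 1).choose 2 : ℂ) - d) *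
            NumberField.dedekindZeta k (s - ((d + 1).choose 2 : ℂ) - d + 1) /
          NumberField.dedekindZeta k (s - ((d + 1).choose 2 : ℂ) + 1)) := by
  refine ⟨fun I _ ↦ AskZeta.finite_gammaGroup_obj k d I, ⟨?_, ?_⟩, fun s hs ↦ ⟨?_, ?_⟩⟩
  · rw [AskZeta.dedekindZetaFormal_eq]
    exact AskZeta.isUnit_shiftedZeta _
  · simp only [AskZeta.dedekindZetaFormal_eq, AskZeta.ccZetaFormal_gammaGroup]
    exact AskZeta.solutionDensity_mul_shiftedZeta d _
  · have hd : (0 : ℝ) ≤ d := Nat.cast_nonneg d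
    exact AskZeta.dedekindZeta_ne_zero k (by simp; linarith)
  · exact AskZeta.hasSum_ccZetaTerm k d hs
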